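/- All graphs are finite, simple and undirected unless stated otherwise. For $r\ge 0$, an $r$-shallow minor of $G$ is a graph obtained from a family of pairwise disjoint vertex sets of $G$, each of which induces a connected subgraph of radius at most $r$, by taking these sets as vertices and joining some pairs of sets between which $G$ has an edge. Let $\nabla_r(G)$ be the maximum of $|E(H)|/|V(H)|$ over all nonempty $r$-shallow minors $H$ of $G$ (and $0$ if $G$ is empty). A graph class $\mathcal C$ has bounded expansion if there is a function $f$ such that $\nabla_r(G)\le f(r)$ for all $G\in\mathcal C$ and all $r\ge 0$. For a directed graph $D$, $\Delta^-(D)$ is its maximal indegree. A directed graph $D'\supseteq D$ on the same vertex set is a $1$-transitive fraternal augmentation of $D$ if for all distinct $u,w$ and all $v$: (transitivity) if $uv, vw\in D$ then $uw\in D'$; (fraternity) if $uv, wv\in D$ then $uw\in D'$ or $wu\in D'$; (tightness) each arc of $D'$ that is not in $D$ is an arc $uw$ with $u\ne w$ for which there is a vertex $v$ with $uv,vw\in D$ or $uv,wv\in D$. The greedy orientation of a graph repeatedly deletes a vertex $y$ of minimum degree in the remaining graph and orients all edges between $y$ and the remaining vertices towards $y$. The greedy augmentation of a directed graph $D$ is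 a $1$-transitive fraternal augmentation of $D$ obtained by adding to $D$ all arcs forced by transitivity together with the arcs of a greedy orientation of an undirected graph $F$, where every edge $uw$ of $F$ is a fraternal pair ($uv,wv\in D$ for some $v$); fraternal pairs that are already joined by an arc may or may not be in $F$, all others are in $F$. Fix an arbitrary deterministic implementation of these two procedures (of Nešetřil and Ossona de Mendez), with any rule for breaking ties and for treating fraternal pairs that are already joined; its outputs are called *the* orientation of a graph and *the* $1$-transitive fraternal augmentation of a directed graph. A directed graph $D'\supseteq D$ on the same vertex set is a flip of $D$ if $uv\in D'\setminus D$ implies $vu\in D$, and $\Delta^-(D')\le\Delta^-(D)+1$. A sequence $G_0\subseteq G_1\subseteq G_2\subseteq\cdots$ of directed graphs is a transitive fraternal flip augmentation of $G$ if $G_0$ is the orientation of $G$ and, for every $i\ge 0$, $G_{i+1}$ is a flip of $G_i$ or the $1$-transitive fraternal augmentation of $G_i$. **Lemma.** A graph class $\mathcal C$ has bounded expansion if and only if there exists a function $\Gamma_{\mathcal C}\colon\mathbf N\to\mathbf N$ such that every graph $G\in\mathcal C$ and every transitive fraternal flip augmentation $G_0\subseteq G_1\subseteq\cdots$ of $G$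 satisfy $\Delta^-(G_i)\le\Gamma_{\mathcal C}(i)$ for every $i\ge 0$. -/

import Mathlib

open scoped NNReal ENNReal

universe u v

/-- A finite simple undirected graph, with vertices in the universe `u`. -/
structure FinGraph where
  V : Type u
  [fin : Fintype V]
  graph : SimpleGraph V

attribute [instance] FinGraph.fin

/-! ### Shallow minors and bounded expansion -/

/-- `H` is an `r`-shallow minor of `G`: the vertices of `H` are represented by pairwise disjoint
branch sets `B w`, each of radius at most `r` inside `G[B w]` (measured from a center `c w`), and
every edge of `H` is realised by an edge of `G` between the two branch sets. -/
def IsShallowMinor {W : Type v} {V : Type u} (r : ℕ) (H : SimpleGraph W) (G : SimpleGraph V) :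
    Prop :=
  ∃ (B : W → Set V) (c : W → V),
    (∀ w, c w ∈ B w) ∧
    (∀ w w', w ≠ w' → Disjoint (B w) (B w')) ∧
    (∀ w, ∀ x ∈ B w, ∃ p : G.Walk (c w) x, p.length ≤ r ∧ ∀ y ∈ p.support, y ∈ B w) ∧
    (∀ w w', H.Adj w w' → ∃ x ∈ B w, ∃ y ∈ B w', G.Adj x y)

/-- `∇_r(G)`: the supremum of `|E(H)| / |V(H)|` over all finite `r`-shallow minors `H` of `G`
(the empty minor contributes `0 / 0 = 0`). -/
noncomputable def grad {V : Type u} (r : ℕ) (G : SimpleGraph V) : ℝ≥0∞ :=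
  ⨆ (k : ℕ) (H : SimpleGraph (Fin k)) (_ : IsShallowMinor r H G),
    (H.edgeSet.ncard : ℝ≥0∞) / (k : ℝ≥0∞)

/-- A graph class has bounded expansion if, for each `r`, the value `∇_r` is bounded by a (finite)
constant on the class. -/
def BoundedExpansion (C : Set FinGraph.{u}) : Prop :=
  ∃ f : ℕ → ℝ≥0, ∀ r : ℕ, ∀ G ∈ C, grad r G.graph ≤ (f r : ℝ≥0∞)

/-! ### Directed graphs: `D.Adj u v` is the arc `uv` from `u` to `v` -/

/-- The maximal indegree `Δ⁻(D)` (`0` for the graph without vertices). -/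
noncomputable def maxInDegree {V : Type u} [Fintype V] (D : Digraph V) : ℕ :=
  Finset.univ.sup fun y : V => {x : V | D.Adj x y}.ncard

/-- `D'` is a `1`-transitive fraternal augmentation of `D`. The end points `x`, `y` of the arcs in
the rules are distinct, as no loops are ever created. -/
structure IsTransFratAug {V : Type u} (D D' : Digraph V) : Prop where
  le : ∀ x y, D.Adj x y → D'.Adj x y
  transitivity : ∀ x z y, x ≠ y → D.Adj x z → D.Adj z y → D'.Adj x y
  fraternity : ∀ x z y, x ≠ y → D.Adj x z → D.Adj y z → D'.Adj x y ∨ D'.Adj y x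
  tightness : ∀ x y, D'.Adj x y → ¬ D.Adj x y →
    x ≠ y ∧ ∃ z, (D.Adj x z ∧ D.Adj z y) ∨ (D.Adj x z ∧ D.Adj y z)

/-- `D'` is a flip of `D`: some reversed arcs are added, and the maximal indegree grows by at
most one. -/
structure IsFlip {V : Type u} [Fintype V] (D D' : Digraph V) : Prop where
  le : ∀ x y, D.Adj x y → D'.Adj x y
  reversed : ∀ x y, D'.Adj x y → ¬ D.Adj x y → D.Adj y x
  indegree : maxInDegree D' ≤ maxInDegree D + 1

/-! ### The construction of Nešetřil and Ossona de Mendez -/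

/-- `D` is an output of the greedy orientation procedure on `G`: the vertices are deleted one by
one, always one of minimum degree in the graph that is left (`σ` numbers them in the order of
deletion), and at the deletion of a vertex `y` all edges `xy` to the vertices `x` that are left
become arcs from `x` to `y`. -/
def IsGreedyOrientation {V : Type u} (G : SimpleGraph V) (D : Digraph V) : Prop :=
  ∃ σ : V → ℕ, Function.Injective σ ∧
    (∀ y x, σ y ≤ σ x →
      {w | G.Adj y w ∧ σ y ≤ σ w}.ncard ≤ {w | G.Adj x w ∧ σ y ≤ σ w}.ncard) ∧
    (∀ x y, D.Adj x y ↔ G.Adj x y ∧ σ y < σ x)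

/-- `D'` is an output of the augmentation procedure on `D`: it is a `1`-transitive fraternal
augmentation of `D` that arises by adding all transitive arcs, collecting fraternal pairs as the
edges of an undirected graph `F`, and adding the arcs of a greedy orientation `O` of `F`. By the
fraternity rule `F` contains every fraternal pair that is not yet joined by an arc; a fraternal
pair that is already joined may be put into `F` or left out. -/
def IsGreedyAug {V : Type u} (D D' : Digraph V) : Prop :=
  IsTransFratAug D D' ∧
    ∃ (F : SimpleGraph V) (O : Digraph V),
      (∀ x y, F.Adj x y → ∃ z, D.Adj x z ∧ D.Adj y z) ∧
      IsGreedyOrientation F O ∧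
      ∀ x y, D'.Adj x y ↔
        D.Adj x y ∨ (x ≠ y ∧ ∃ z, D.Adj x z ∧ D.Adj z y) ∨ O.Adj x y

/-- A (deterministic) implementation of the two procedures on finite graphs. Its only freedom is
the one which the procedures leave: breaking ties between vertices of minimum degree, and the
treatment of fraternal pairs that are already joined. -/
structure GreedyAlgorithm where
  orient : ∀ (V : Type u) [Finite V], SimpleGraph V → Digraph V
  augment : ∀ (V : Type u) [Finite V], Digraph V → Digraph V
  orient_spec : ∀ (V : Type u) [Finite V] (G : SimpleGraph V),
    IsGreedyOrientation G (orient V G)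
  augment_spec : ∀ (V : Type u) [Finite V] (D : Digraph V), IsGreedyAug D (augment V D)

/-- The sequence `S 0 ⊆ S 1 ⊆ …` is a transitive fraternal flip augmentation of `G`, where
*the* orientation and *the* `1`-transitive fraternal augmentation are those computed by `A`. -/
structure IsTransFratFlipAug (A : GreedyAlgorithm.{u}) (G : FinGraph.{u})
    (S : ℕ → Digraph G.V) : Prop where
  zero : S 0 = A.orient G.V G.graph
  step : ∀ i, IsFlip (S i) (S (i + 1)) ∨ S (i + 1) = A.augment G.V (S i)

/-! ### The procedures have outputs, so implementations exist -/

theorem exists_greedyOrientation {V : Type u} [Finite V] (G : SimpleGraph V) :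
    ∃ D, IsGreedyOrientation G D := by
  classical
  have := Fintype.ofFinite V
  -- enumerate the vertices that are left, starting with the number `n`
  have key : ∀ (k : ℕ) (s : Finset V) (n : ℕ), s.card = k → ∃ σ : V → ℕ, Set.InjOn σ s ∧
      (∀ x ∈ s, n ≤ σ x) ∧ ∀ y ∈ s, ∀ x ∈ s, σ y ≤ σ x →
        {w | w ∈ s ∧ G.Adj y w ∧ σ y ≤ σ w}.ncard ≤
          {w | w ∈ s ∧ G.Adj x w ∧ σ y ≤ σ w}.ncard := by
    intro k
    induction k with
    | zero =>
      intro s n hs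
      obtain rfl := Finset.card_eq_zero.mp hs
      exact ⟨fun _ => 0, by simp, by simp, by simp⟩
    | succ k ih =>
      intro s n hs
      have hne : s.Nonempty := by
        rw [← Finset.card_pos]; omega
      obtain ⟨m, hm, hmin⟩ := Finset.exists_min_image s
        (fun y => {w | w ∈ s ∧ G.Adj y w}.ncard) hne
      obtain ⟨σ, hinj, hlow, hσ⟩ := ih (s.erase m) (n + 1)
        (by rw [Finset.card_erase_of_mem hm]; omega)
      have hτ : ∀ x, x ≠ m → Function.update σ m n x = σ x := fun x hx =>
        Function.update_of_ne hx _ _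
      have hτm : Function.update σ m n m = n := Function.update_self _ _ _
      have hlt : ∀ x ∈ s, x ≠ m → n + 1 ≤ σ x := fun x hx hxm =>
        hlow x (Finset.mem_erase.mpr ⟨hxm, hx⟩)
      have hall : ∀ x ∈ s, n ≤ Function.update σ m n x := by
        intro x hx
        by_cases hxm : x = m
        · subst hxm; rw [hτm]
        · rw [hτ x hxm]; have := hlt x hx hxm; omega
      refine ⟨Function.update σ m n, ?_, hall, ?_⟩
      · intro x hx y hy hxy
        by_cases hxm : x = m <;> by_cases hym : y = m
        · rw [hxm, hym]
        · rw [hxm, hτm, hτ y hym] at hxy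
          have := hlt y hy hym; omega
        · rw [hym, hτm, hτ x hxm] at hxy
          have := hlt x hx hxm; omega
        · rw [hτ x hxm, hτ y hym] at hxy
          exact hinj (Finset.mem_coe.mpr (Finset.mem_erase.mpr ⟨hxm, hx⟩))
            (Finset.mem_coe.mpr (Finset.mem_erase.mpr ⟨hym, hy⟩)) hxy
      · intro y hy x hx hyx
        by_cases hym : y = m
        · subst hym
          rw [hτm]
          have e : ∀ z, {w | w ∈ s ∧ G.Adj z w ∧ n ≤ Function.update σ y n w} =
              {w | w ∈ s ∧ G.Adj z w} := by
            intro z; ext w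
            exact ⟨fun h => ⟨h.1, h.2.1⟩, fun h => ⟨h.1, h.2, hall w h.1⟩⟩
          rw [e, e]
          exact hmin x hx
        · have hxm : x ≠ m := by
            rintro rfl
            rw [hτm, hτ y hym] at hyx
            have := hlt y hy hym; omega
          have e : ∀ z, {w | w ∈ s ∧ G.Adj z w ∧ σ y ≤ Function.update σ m n w} =
              {w | w ∈ s.erase m ∧ G.Adj z w ∧ σ y ≤ σ w} := by
            intro z; ext w
            by_cases hwm : w = m
            · subst hwm
              have := hlt y hy hym
              simp only [Set.mem_ofPred_eq, hτm, Finset.mem_erase]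
              constructor
              · rintro ⟨-, -, h⟩; omega
              · rintro ⟨⟨h, -⟩, -⟩; exact absurd rfl h
            · simp [hwm]
          rw [hτ y hym, e, e]
          rw [hτ y hym, hτ x hxm] at hyx
          exact hσ y (Finset.mem_erase.mpr ⟨hym, hy⟩) x (Finset.mem_erase.mpr ⟨hxm, hx⟩) hyx
  obtain ⟨σ, hinj, -, hσ⟩ := key _ Finset.univ 0 rfl
  refine ⟨⟨fun x y => G.Adj x y ∧ σ y < σ x⟩, σ, ?_, ?_, fun _ _ => Iff.rfl⟩
  · intro x y h
    exact hinj (by simp) (by simp) h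
  · intro y x h
    simpa using hσ y (Finset.mem_univ _) x (Finset.mem_univ _) h

theorem exists_greedyAug {V : Type u} [Finite V] (D : Digraph V) : ∃ D', IsGreedyAug D D' := by
  let F : SimpleGraph V :=
    { Adj := fun x y => x ≠ y ∧ ∃ z, D.Adj x z ∧ D.Adj y z
      symm := ⟨fun x y ⟨h, z, h1, h2⟩ => ⟨h.symm, z, h2, h1⟩⟩
      loopless := ⟨fun x h => h.1 rfl⟩ }
  obtain ⟨O, hO⟩ := exists_greedyOrientation F
  refine ⟨⟨fun x y => D.Adj x y ∨ (x ≠ y ∧ ∃ z, D.Adj x z ∧ D.Adj z y) ∨ O.Adj x y⟩, ?_,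
    F, O, fun x y h => h.2, hO, fun _ _ => Iff.rfl⟩
  obtain ⟨σ, hinj, -, hσ⟩ := hO
  refine ⟨fun x y h => Or.inl h, fun x z y h h1 h2 => Or.inr (Or.inl ⟨h, z, h1, h2⟩), ?_, ?_⟩
  · intro x z y h h1 h2
    rcases lt_or_gt_of_ne (hinj.ne h) with hlt | hlt
    · exact Or.inr (Or.inr (Or.inr ((hσ y x).mpr ⟨⟨h.symm, z, h2, h1⟩, hlt⟩)))
    · exact Or.inl (Or.inr (Or.inr ((hσ x y).mpr ⟨⟨h, z, h1, h2⟩, hlt⟩)))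
  · rintro x y (h | ⟨h, z, h1, h2⟩ | h) hn
    · exact absurd h hn
    · exact ⟨h, z, Or.inl ⟨h1, h2⟩⟩
    · obtain ⟨⟨h, z, h1, h2⟩, -⟩ := (hσ x y).mp h
      exact ⟨h, z, Or.inr ⟨h1, h2⟩⟩

theorem greedyAlgorithm_nonempty : Nonempty GreedyAlgorithm.{u} :=
  ⟨{ orient := fun _ _ G => (exists_greedyOrientation G).choose
     augment := fun _ _ D => (exists_greedyAug D).choose
     orient_spec := fun _ _ G => (exists_greedyOrientation G).choose_spec
     augment_spec := fun _ _ D => (exists_greedyAug D).choose_spec }⟩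

/-!
For a digraph `D`, gradients are taken of its underlying graph `D.toSimpleGraphInclusive`.

*Bounded indegrees give bounded expansion.* It suffices to look at the sequence that only augments.
Among the three edges of a walk `a b c d` the arc between `b` and `c` enters an inner vertex, so
that one augmentation makes a shortcut around it (`IsTransFratAug.linkedIn_shorten`). Hence
after `2r + 1` augmentations two vertices at distance at most `2r + 1` inside a set `B` are equal,
adjacent, or have a common in-neighbour in `B`. For the centers of two adjacent branch sets of an
`r`-shallow minor and the union `B` of these sets, this gives an arc from one of the branch sets to
the center of the other one. Since the branch sets are disjoint, the edges of the minor are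
oriented with indegrees at most the maximal indegree (`grad_le_of_isTransFratAug`).

*Bounded expansion gives bounded indegrees.* By induction on the number of steps, the maximal
indegree and all gradients stay bounded (`exists_bound_of_grad_le`). A flip does not change the
underlying graph. A greedy orientation has indegrees at most `2 ∇₀`, as the minimum degree of a
subgraph is at most its average degree (`IsGreedyOrientation.ncard_le`); so after an augmentation
everything reduces to the gradients of the graph `augGraph D` that contains all new pairs. If `D`
has indegrees at most `d`, then adding to each branch set the out-neighbours of its vertices turns
an `r`-shallow minor of `augGraph D` into a minor model in `D` of radius `2r + 1` in which the branch
sets may overlap, but each vertex is in at most `d + 1` of them (`grad_augGraph_le`). Such a model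
is sparse by a random choice (`ncard_edgeSet_le_of_overlapping`): assign each vertex to one of its
branch sets; what remains connected to the centers is an honest shallow minor, and each edge
survives with a probability bounded below in terms of `d` and `r`, except for the few edges whose
branch sets have the same center.
-/

/-! ### Bounded walks inside a vertex set -/

/-- `y` can be reached from `x` by a walk of length at most `n` that stays inside `B`. -/
def LinkedIn {V : Type u} (G : SimpleGraph V) (B : Set V) (n : ℕ) (x y : V) : Prop :=
  ∃ p : G.Walk x y, p.length ≤ n ∧ ∀ z ∈ p.support, z ∈ B

namespace LinkedIn

variable {V : Type u} {G G' : SimpleGraph V} {B B' : Set V} {m n : ℕ} {x y z : V}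

theorem left_mem (h : LinkedIn G B n x y) : x ∈ B := by
  obtain ⟨p, -, hp⟩ := h
  exact hp _ p.start_mem_support

theorem right_mem (h : LinkedIn G B n x y) : y ∈ B := by
  obtain ⟨p, -, hp⟩ := h
  exact hp _ p.end_mem_support

theorem refl (n : ℕ) (hx : x ∈ B) : LinkedIn G B n x x :=
  ⟨.nil, by simp, by simpa using hx⟩

theorem of_adj (h : G.Adj x y) (hx : x ∈ B) (hy : y ∈ B) : LinkedIn G B 1 x y :=
  ⟨h.toWalk, by simp, by simp [hx, hy]⟩

theorem trans (h : LinkedIn G B m x y) (h' : LinkedIn G B n y z) : LinkedIn G B (m + n) x z := by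
  obtain ⟨p, hp, hpB⟩ := h
  obtain ⟨q, hq, hqB⟩ := h'
  refine ⟨p.append q, by rw [SimpleGraph.Walk.length_append]; omega, fun w hw => ?_⟩
  rcases (SimpleGraph.Walk.mem_support_append_iff _ _).mp hw with h | h
  exacts [hpB _ h, hqB _ h]

theorem symm (h : LinkedIn G B n x y) : LinkedIn G B n y x := by
  obtain ⟨p, hp, hpB⟩ := h
  exact ⟨p.reverse, by simpa using hp, by simpa using hpB⟩

theorem mono (h : LinkedIn G B m x y) (hG : G ≤ G') (hB : B ⊆ B') (hmn : m ≤ n) :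
    LinkedIn G' B' n x y := by
  obtain ⟨p, hp, hpB⟩ := h
  exact ⟨p.mapLe hG, by simpa using hp.trans hmn, fun z hz => hB (hpB z (by simpa using hz))⟩

/-- A walk witnessing a link stays inside the ball around its starting point. -/
theorem ball (h : LinkedIn G B n x y) : LinkedIn G {z | LinkedIn G B n x z} n x y := by
  classical
  obtain ⟨p, hp, hpB⟩ := h
  exact ⟨p, hp, fun z hz => ⟨p.takeUntil z hz, (p.length_takeUntil_le_length hz).trans hp,
    fun w hw => hpB w (p.support_takeUntil_subset_support hz hw)⟩⟩

end LinkedIn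

/-- Two walks from distinct vertices `a`, `b` to a common end can be cut so that they end in
adjacent vertices: the last edge of a nontrivial one is dropped. -/
theorem exists_adj_ends_of_common_end {V : Type u} {G : SimpleGraph V} {a b v : V} (hab : a ≠ b)
    (p : G.Walk a v) (q : G.Walk b v) :
    ∃ (x y : V) (p' : G.Walk a x) (q' : G.Walk b y), G.Adj x y ∧
      p'.support ⊆ p.support ∧ q'.support ⊆ q.support ∧ p'.length ≤ p.length ∧
      q'.length ≤ q.length ∧ p'.length + q'.length < p.length + q.length := by
  by_cases hp : p.Nil
  · have hq : ¬ q.Nil := fun hq => hab (hp.eq.trans hq.eq.symm)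
    have h := SimpleGraph.Walk.not_nil_iff_lt_length.mp hq
    refine ⟨v, q.penultimate, p, q.dropLast, (q.adj_penultimate hq).symm, by simp, ?_, le_rfl, ?_,
      ?_⟩
    · rw [SimpleGraph.Walk.support_dropLast hq]; exact List.dropLast_subset _
    · simp
    · simp; omega
  · have h := SimpleGraph.Walk.not_nil_iff_lt_length.mp hp
    refine ⟨p.penultimate, v, p.dropLast, q, p.adj_penultimate hp, ?_, by simp, ?_, le_rfl, ?_⟩
    · rw [SimpleGraph.Walk.support_dropLast hp]; exact List.dropLast_subset _
    · simp
    · simp; omega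

/-- Two walks from distinct vertices with adjacent ends can be cut to disjoint walks with adjacent
ends. -/
theorem exists_disjoint_walks_of_adj_ends {V : Type u} {G : SimpleGraph V} {a b : V}
    (hab : a ≠ b) {x y : V} (p : G.Walk a x) (q : G.Walk b y) (hxy : G.Adj x y) :
    ∃ (x' y' : V) (p' : G.Walk a x') (q' : G.Walk b y'), G.Adj x' y' ∧
      p'.support ⊆ p.support ∧ q'.support ⊆ q.support ∧ p'.length ≤ p.length ∧
      q'.length ≤ q.length ∧ ∀ z ∈ p'.support, z ∉ q'.support := by
  classical
  induction hn : p.length + q.length using Nat.strong_induction_on generalizing x y with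
  | _ n ih =>
    by_cases h : ∀ z ∈ p.support, z ∉ q.support
    · exact ⟨x, y, p, q, hxy, by simp, by simp, le_rfl, le_rfl, h⟩
    push Not at h
    obtain ⟨v, hvp, hvq⟩ := h
    have hlp := p.length_takeUntil_le_length hvp
    have hlq := q.length_takeUntil_le_length hvq
    obtain ⟨x₁, y₁, p₁, q₁, h₁, hsp₁, hsq₁, hlp₁, hlq₁, hlt⟩ :=
      exists_adj_ends_of_common_end hab (p.takeUntil v hvp) (q.takeUntil v hvq)
    obtain ⟨x₂, y₂, p₂, q₂, h₂, hsp₂, hsq₂, hlp₂, hlq₂, hd⟩ :=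
      ih (p₁.length + q₁.length) (by omega) p₁ q₁ h₁ rfl
    exact ⟨x₂, y₂, p₂, q₂, h₂,
      fun z hz => p.support_takeUntil_subset_support hvp (hsp₁ (hsp₂ hz)),
      fun z hz => q.support_takeUntil_subset_support hvq (hsq₁ (hsq₂ hz)),
      by omega, by omega, hd⟩

/-- Two connected sets of radius `r` with distinct centers that meet or are joined by an edge
contain disjoint connected sets with at most `r + 1` vertices each, with the same centers, that
are joined by an edge. -/
theorem LinkedIn.exists_disjoint_finsets {V : Type u} {G : SimpleGraph V} {B B' : Set V} {r : ℕ}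
    {a b x y : V} (hab : a ≠ b) (hx : LinkedIn G B r a x) (hy : LinkedIn G B' r b y)
    (hxy : x = y ∨ G.Adj x y) :
    ∃ X Y : Finset V, (X : Set V) ⊆ B ∧ (Y : Set V) ⊆ B' ∧ Disjoint X Y ∧
      X.card ≤ r + 1 ∧ Y.card ≤ r + 1 ∧
      ∃ x' y', G.Adj x' y' ∧ LinkedIn G X r a x' ∧ LinkedIn G Y r b y' := by
  classical
  obtain ⟨p, hp, hpB⟩ := hx
  obtain ⟨q, hq, hqB⟩ := hy
  obtain ⟨x₁, y₁, p₁, q₁, h₁, hsp₁, hsq₁, hlp₁, hlq₁⟩ :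
      ∃ (x₁ y₁ : V) (p₁ : G.Walk a x₁) (q₁ : G.Walk b y₁), G.Adj x₁ y₁ ∧
        p₁.support ⊆ p.support ∧ q₁.support ⊆ q.support ∧ p₁.length ≤ p.length ∧
        q₁.length ≤ q.length := by
    rcases hxy with rfl | hxy
    · obtain ⟨x₁, y₁, p₁, q₁, h₁, h₂, h₃, h₄, h₅, -⟩ := exists_adj_ends_of_common_end hab p q
      exact ⟨x₁, y₁, p₁, q₁, h₁, h₂, h₃, h₄, h₅⟩
    · exact ⟨x, y, p, q, hxy, by simp, by simp, le_rfl, le_rfl⟩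
  obtain ⟨x₂, y₂, p₂, q₂, h₂, hsp₂, hsq₂, hlp₂, hlq₂, hd⟩ :=
    exists_disjoint_walks_of_adj_ends hab p₁ q₁ h₁
  have hcp := p₂.support.toFinset_card_le
  have hcq := q₂.support.toFinset_card_le
  rw [SimpleGraph.Walk.length_support] at hcp hcq
  refine ⟨p₂.support.toFinset, q₂.support.toFinset, fun z hz => hpB z (hsp₁ (hsp₂ ?_)),
    fun z hz => hqB z (hsq₁ (hsq₂ ?_)), ?_, by omega, by omega, x₂, y₂, h₂,
    ⟨p₂, by omega, by simp⟩, ⟨q₂, by omega, by simp⟩⟩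
  · simpa using hz
  · simpa using hz
  · rw [Finset.disjoint_left]
    intro z hz hz'
    exact hd z (by simpa using hz) (by simpa using hz')

/-! ### Counting edges of shallow minors -/

theorem grad_le_natCast {V : Type u} {G : SimpleGraph V} {r c : ℕ}
    (h : ∀ (k : ℕ) (H : SimpleGraph (Fin k)), IsShallowMinor r H G → H.edgeSet.ncard ≤ c * k) :
    grad r G ≤ c := by
  refine iSup_le fun k => iSup_le fun H => iSup_le fun hH => ENNReal.div_le_of_le_mul ?_
  exact_mod_cast h k H hH

theorem IsShallowMinor.ncard_edgeSet_le {W : Type v} [Fintype W] {V : Type u}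
    {H : SimpleGraph W} {G : SimpleGraph V} {r c : ℕ} (h : IsShallowMinor r H G)
    (hc : grad r G ≤ c) : H.edgeSet.ncard ≤ c * Fintype.card W := by
  obtain ⟨B, ctr, hctr, hdisj, hrad, hadj⟩ := h
  let e := Fintype.equivFin W
  let H' : SimpleGraph (Fin (Fintype.card W)) := H.comap e.symm
  have hH' : IsShallowMinor r H' G :=
    ⟨fun i => B (e.symm i), fun i => ctr (e.symm i), fun i => hctr _,
      fun i j hij => hdisj _ _ (e.symm.injective.ne hij), fun i => hrad _,
      fun i j hij => hadj _ _ hij⟩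
  have hcard : H'.edgeSet.ncard = H.edgeSet.ncard :=
    Nat.card_congr (SimpleGraph.Iso.comap e.symm H).mapEdgeSet
  have hle : (H'.edgeSet.ncard : ℝ≥0∞) / (Fintype.card W : ℕ) ≤ c := by
    refine le_trans ?_ hc
    exact le_iSup_of_le (Fintype.card W) (le_iSup_of_le H' (le_iSup_of_le hH' le_rfl))
  rw [← hcard]
  rcases isEmpty_or_nonempty W with hW | hW
  · have : H'.edgeSet = ∅ := by
      have : IsEmpty (Fin (Fintype.card W)) := e.symm.isEmpty
      exact Set.eq_empty_of_isEmpty _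
    simp [this]
  · rw [ENNReal.div_le_iff (by simp) (by simp)] at hle
    exact_mod_cast hle

/-- A set of pairs that can be oriented with all indegrees at most `d` has at most `d` pairs per
vertex. -/
theorem ncard_le_of_orientation {W : Type v} [Fintype W] {E : Set (Sym2 W)} {d : ℕ}
    (R : W → W → Prop) (hR : ∀ a b, s(a, b) ∈ E → R a b ∨ R b a)
    (hd : ∀ b, {a | R a b}.ncard ≤ d) : E.ncard ≤ d * Fintype.card W := by
  classical
  let T : Finset (Σ _ : W, W) := Finset.univ.sigma fun b => {a | R a b}
  have hT : T.card ≤ d * Fintype.card W := by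
    rw [Finset.card_sigma, mul_comm]
    refine (Finset.sum_le_card_nsmul _ _ d fun b _ => ?_).trans (by simp)
    rw [← Set.ncard_coe_finset]
    simpa using hd b
  have hE : E ⊆ (T.image fun q => s(q.2, q.1) : Finset (Sym2 W)) := by
    intro e he
    induction e with
    | _ a b =>
      rw [Finset.mem_coe, Finset.mem_image]
      rcases hR a b he with h | h
      · exact ⟨⟨b, a⟩, by simpa [T] using h, rfl⟩
      · exact ⟨⟨a, b⟩, by simpa [T] using h, Sym2.eq_swap⟩
  calc E.ncard ≤ _ := Set.ncard_le_ncard hE (Finset.finite_toSet _)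
    _ ≤ T.card := by rw [Set.ncard_coe_finset]; exact Finset.card_image_le
    _ ≤ _ := hT

/-! ### Overlapping minor models -/

/-- Edge count for a family of connected sets of radius `r` in which only some members have their
center: the members taking part in an edge form a shallow minor. -/
theorem ncard_edgeSet_le_of_linkedIn {W : Type v} [Fintype W] {V : Type u} {G : SimpleGraph V}
    {r c : ℕ} (hc : grad r G ≤ c) (K : SimpleGraph W) (T : W → Set V) (ctr : W → V)
    (hdisj : ∀ a b, a ≠ b → Disjoint (T a) (T b))
    (hadj : ∀ a b, K.Adj a b → ∃ x y, LinkedIn G (T a) r (ctr a) x ∧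
      LinkedIn G (T b) r (ctr b) y ∧ G.Adj x y) :
    K.edgeSet.ncard ≤ c * Fintype.card W := by
  classical
  let s : Set W := {w | ctr w ∈ T w}
  have hs : K.support ⊆ s := by
    rintro a ⟨b, hab⟩
    obtain ⟨x, y, hx, -, -⟩ := hadj a b hab
    exact hx.left_mem
  have hminor : IsShallowMinor r (K.induce s) G := by
    refine ⟨fun w => {x | LinkedIn G (T w) r (ctr w) x}, fun w => ctr w,
      fun w => LinkedIn.refl _ w.2, fun a b hab => ?_, fun w x hx => hx.ball, fun a b hab => ?_⟩
    · exact (hdisj a b fun h => hab (Subtype.ext h)).mono (fun x hx => hx.right_mem)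
        fun x hx => hx.right_mem
    · obtain ⟨x, y, hx, hy, hxy⟩ := hadj a b hab
      exact ⟨x, hx, y, hy, hxy⟩
  have h := hminor.ncard_edgeSet_le hc
  have hcard : (K.induce s).edgeSet.ncard = K.edgeSet.ncard := by
    rw [← SimpleGraph.coe_edgeFinset, ← SimpleGraph.coe_edgeFinset, Set.ncard_coe_finset,
      Set.ncard_coe_finset]
    exact SimpleGraph.card_edgeFinset_induce_of_support_subset hs
  rw [← hcard]
  exact h.trans (Nat.mul_le_mul_left _ (Fintype.card_subtype_le _))

/-- A uniformly random function `V → α` agrees with `g` on `S` with probability at least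
`|α| ^ (-|S|)`. -/
theorem card_fun_le_card_agree_mul_pow {V : Type u} {α : Type v} [Fintype V] [DecidableEq V]
    [Fintype α] [DecidableEq α] (S : Finset V) (g : V → α) :
    Fintype.card (V → α) ≤
      (Finset.univ.filter fun f : V → α => ∀ v ∈ S, f v = g v).card *
        Fintype.card α ^ S.card := by
  let φ : (V → α) → {f : V → α // ∀ v ∈ S, f v = g v} × (S → α) := fun f =>
    (⟨fun v => if v ∈ S then g v else f v, fun v hv => by simp [hv]⟩, fun v => f v)
  have hφ : Function.Injective φ := by
    intro f f' h
    have h₁ := congrArg (fun q => q.1.1) h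
    have h₂ := congrArg (fun q => q.2) h
    funext v
    by_cases hv : v ∈ S
    · exact congrFun h₂ ⟨v, hv⟩
    · simpa [φ, hv] using congrFun h₁ v
  have := Fintype.card_le_of_injective φ hφ
  rwa [Fintype.card_prod, Fintype.card_fun (α := S), Fintype.card_coe, Fintype.card_subtype]
    at this

/-- A minor model with branch sets of radius `r` in which every vertex lies in at most `d + 1`
branch sets, and in which edges are realised by an edge or a common vertex, is sparse if the
`r`-shallow minors of `G` are. Every vertex of `G` is given at random to one of its at most
`d + 1` branch sets; this makes them disjoint, and an edge between branch sets with distinct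
centers survives with probability at least `(d + 1) ^ (-(2 * r + 2))`. -/
theorem ncard_edgeSet_le_of_overlapping {W : Type v} [Fintype W] {V : Type u} [Fintype V]
    {G : SimpleGraph V} {r c d : ℕ} (hc : grad r G ≤ c) (H : SimpleGraph W) (B : W → Set V)
    (ctr : W → V) (hctr : ∀ w, ctr w ∈ B w) (hover : ∀ v, {w | v ∈ B w}.ncard ≤ d + 1)
    (hrad : ∀ w, ∀ x ∈ B w, LinkedIn G (B w) r (ctr w) x)
    (hadj : ∀ a b, H.Adj a b → ∃ x ∈ B a, ∃ y ∈ B b, x = y ∨ G.Adj x y) :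
    H.edgeSet.ncard ≤ ((d + 1) + (d + 1) ^ (2 * r + 2) * c) * Fintype.card W := by
  classical
  -- `lab v` numbers the branch sets that contain `v`
  have hlab : ∀ v, ∃ l : W → Fin (d + 1), Set.InjOn l {w | v ∈ B w} := by
    intro v
    have hle : Fintype.card {w | v ∈ B w} ≤ Fintype.card (Fin (d + 1)) := by
      rw [Fintype.card_fin, ← Nat.card_eq_fintype_card]; exact hover v
    obtain ⟨ι⟩ := Function.Embedding.nonempty_of_card_le hle
    refine ⟨fun w => if h : v ∈ B w then ι ⟨w, h⟩ else 0, fun a ha b hb hab => ?_⟩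
    have ha' : v ∈ B a := ha
    have hb' : v ∈ B b := hb
    simp only [ha', hb', dif_pos] at hab
    exact congrArg Subtype.val (ι.injective hab)
  choose lab hlab using hlab
  let T : (V → Fin (d + 1)) → W → Set V := fun f w => {v | v ∈ B w ∧ f v = lab v w}
  have hTdisj : ∀ f a b, a ≠ b → Disjoint (T f a) (T f b) := fun f a b hab =>
    Set.disjoint_left.mpr fun v ha hb => hab (hlab v ha.1 hb.1 (ha.2.symm.trans hb.2))
  let K : (V → Fin (d + 1)) → SimpleGraph W := fun f =>
    { Adj := fun a b => a ≠ b ∧ ∃ x y, LinkedIn G (T f a) r (ctr a) x ∧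
        LinkedIn G (T f b) r (ctr b) y ∧ G.Adj x y
      symm := ⟨fun a b ⟨h, x, y, hx, hy, hxy⟩ => ⟨h.symm, y, x, hy, hx, hxy.symm⟩⟩
      loopless := ⟨fun a h => h.1 rfl⟩ }
  have hK : ∀ f, (K f).edgeFinset.card ≤ c * Fintype.card W := by
    intro f
    rw [← Set.ncard_coe_finset, SimpleGraph.coe_edgeFinset]
    exact ncard_edgeSet_le_of_linkedIn hc (K f) (T f) ctr (hTdisj f) fun a b h => h.2
  let N := Fintype.card (V → Fin (d + 1))
  have hN : 0 < N := Fintype.card_pos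
  let P := (d + 1) ^ (2 * r + 2)
  -- an edge whose branch sets have distinct centers survives often
  have hsurv : ∀ a b, H.Adj a b → ctr a ≠ ctr b →
      N ≤ (Finset.univ.filter fun f => s(a, b) ∈ (K f).edgeFinset).card * P := by
    intro a b hab hne
    obtain ⟨x, hx, y, hy, hxy⟩ := hadj a b hab
    obtain ⟨X, Y, hXB, hYB, hXY, hX, hY, x', y', hxy', hx', hy'⟩ :=
      (hrad a x hx).exists_disjoint_finsets hne (hrad b y hy) hxy
    have hcard := card_fun_le_card_agree_mul_pow (X ∪ Y)
      fun v => if v ∈ X then lab v a else lab v b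
    refine hcard.trans (Nat.mul_le_mul (Finset.card_le_card fun f hf => ?_) ?_)
    · simp only [Finset.mem_filter, Finset.mem_univ, true_and] at hf ⊢
      rw [SimpleGraph.mem_edgeFinset, SimpleGraph.mem_edgeSet]
      refine ⟨hab.ne, x', y', hx'.mono le_rfl (fun v hv => ⟨hXB hv, ?_⟩) le_rfl,
        hy'.mono le_rfl (fun v hv => ⟨hYB hv, ?_⟩) le_rfl, hxy'⟩
      · have hv' : v ∈ X := hv
        simpa [hv'] using hf v (Finset.mem_union_left _ hv')
      · have hv' : v ∈ Y := hv
        simpa [Finset.disjoint_right.mp hXY hv'] using hf v (Finset.mem_union_right _ hv')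
    · rw [Fintype.card_fin]
      have := Finset.card_union_le X Y
      exact Nat.pow_le_pow_right (Nat.succ_pos d) (by omega)
  let E₁ : Set (Sym2 W) := {e | e ∈ H.edgeSet ∧ ∃ a b, e = s(a, b) ∧ ctr a = ctr b}
  let E₂ : Finset (Sym2 W) :=
    H.edgeFinset.filter fun e => ∀ a b, e = s(a, b) → ctr a ≠ ctr b
  -- a center lies in at most `d + 1` branch sets, so few edges join sets with the same center
  have hE₁ : E₁.ncard ≤ (d + 1) * Fintype.card W := by
    refine ncard_le_of_orientation (fun a b => ctr a = ctr b) ?_ fun b =>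
      (Set.ncard_le_ncard (fun a ha => ?_) (Set.toFinite _)).trans (hover (ctr b))
    · rintro a b ⟨-, a', b', he, h⟩
      rcases Sym2.eq_iff.mp he with ⟨rfl, rfl⟩ | ⟨rfl, rfl⟩
      exacts [Or.inl h, Or.inr h]
    · have ha' : ctr a = ctr b := ha
      exact ha' ▸ hctr a
  -- double counting of the pairs of an assignment `f` and an edge that survives under `f`
  have hE₂ : E₂.card ≤ P * c * Fintype.card W := by
    refine Nat.le_of_mul_le_mul_left ?_ hN
    calc N * E₂.card = ∑ _e ∈ E₂, N := by rw [Finset.sum_const, smul_eq_mul, mul_comm]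
      _ ≤ ∑ e ∈ E₂, (Finset.univ.filter fun f => e ∈ (K f).edgeFinset).card * P := by
          refine Finset.sum_le_sum fun e he => ?_
          obtain ⟨heH, hne⟩ := Finset.mem_filter.mp he
          induction e with
          | _ a b => exact hsurv a b (by simpa using heH) (hne a b rfl)
      _ = (∑ f, (E₂.filter fun e => e ∈ (K f).edgeFinset).card) * P := by
          rw [← Finset.sum_mul]
          congr 1
          exact Finset.sum_card_bipartiteAbove_eq_sum_card_bipartiteBelow
            (fun (e : Sym2 W) (f : V → Fin (d + 1)) => e ∈ (K f).edgeFinset)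
      _ ≤ (∑ _f : V → Fin (d + 1), c * Fintype.card W) * P := by
          refine Nat.mul_le_mul_right _ (Finset.sum_le_sum fun f _ => ?_)
          refine (Finset.card_le_card fun e he => ?_).trans (hK f)
          exact (Finset.mem_filter.mp he).2
      _ = N * (P * c * Fintype.card W) := by
          rw [Finset.sum_const, smul_eq_mul, Finset.card_univ]; ring
  have hsub : H.edgeSet ⊆ E₁ ∪ E₂ := by
    intro e he
    by_cases h : ∀ a b, e = s(a, b) → ctr a ≠ ctr b
    · exact Or.inr (Finset.mem_coe.mpr (Finset.mem_filter.mpr ⟨by simpa using he, h⟩))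
    · push Not at h
      exact Or.inl ⟨he, h⟩
  calc H.edgeSet.ncard ≤ (E₁ ∪ E₂).ncard := Set.ncard_le_ncard hsub (Set.toFinite _)
    _ ≤ E₁.ncard + E₂.card := by
        simpa only [Set.ncard_coe_finset] using Set.ncard_union_le E₁ (E₂ : Set (Sym2 W))
    _ ≤ (d + 1) * Fintype.card W + P * c * Fintype.card W := Nat.add_le_add hE₁ hE₂
    _ = _ := by ring

/-! ### Gradients of subgraphs -/

theorem IsShallowMinor.mono {W : Type v} {V : Type u} {r : ℕ} {H : SimpleGraph W}
    {G G' : SimpleGraph V} (h : IsShallowMinor r H G) (hG : G ≤ G') : IsShallowMinor r H G' := by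
  obtain ⟨B, ctr, hctr, hdisj, hrad, hadj⟩ := h
  refine ⟨B, ctr, hctr, hdisj, fun w x hx => ?_, fun a b hab => ?_⟩
  · exact LinkedIn.mono (hrad w x hx) hG subset_rfl le_rfl
  · obtain ⟨x, hx, y, hy, hxy⟩ := hadj a b hab
    exact ⟨x, hx, y, hy, hG hxy⟩

theorem grad_mono {V : Type u} {G G' : SimpleGraph V} (hG : G ≤ G') (r : ℕ) :
    grad r G ≤ grad r G' :=
  iSup_mono fun _ => iSup_mono fun _ => iSup_mono' fun h => ⟨h.mono hG, le_rfl⟩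

/-- Among disjoint sets, at most `|N|` meet `N`. -/
theorem ncard_meeting_le {W : Type v} {V : Type u} [Finite V] {B : W → Set V}
    (hdisj : ∀ a b, a ≠ b → Disjoint (B a) (B b)) (N : Set V) :
    {w | ∃ x ∈ B w, x ∈ N}.ncard ≤ N.ncard := by
  have h : ∀ w : {w | ∃ x ∈ B w, x ∈ N}, ∃ x : N, (x : V) ∈ B w := fun ⟨_, x, hx, hxN⟩ =>
    ⟨⟨x, hxN⟩, hx⟩
  choose g hg using h
  refine Nat.card_le_card_of_injective g fun a b hab => ?_
  by_contra hne
  exact Set.disjoint_left.mp (hdisj a b fun h => hne (Subtype.ext h)) (hg a) (hab ▸ hg b)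

/-! ### Indegrees -/

theorem ncard_le_maxInDegree {V : Type u} [Fintype V] (D : Digraph V) (y : V) :
    {x | D.Adj x y}.ncard ≤ maxInDegree D :=
  Finset.le_sup (f := fun y : V => {x : V | D.Adj x y}.ncard) (Finset.mem_univ y)

theorem maxInDegree_le {V : Type u} [Fintype V] {D : Digraph V} {d : ℕ}
    (h : ∀ y, {x | D.Adj x y}.ncard ≤ d) : maxInDegree D ≤ d :=
  Finset.sup_le fun y _ => h y

/-- At the deletion of `y` the remaining graph has minimum degree equal to the indegree of `y`,
and average degree at most `2 * ∇₀`. -/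
theorem IsGreedyOrientation.ncard_le {V : Type u} [Finite V] {G : SimpleGraph V} {D : Digraph V}
    (h : IsGreedyOrientation G D) {c : ℕ} (hc : grad 0 G ≤ c) (y : V) :
    {x | D.Adj x y}.ncard ≤ 2 * c := by
  classical
  have := Fintype.ofFinite V
  obtain ⟨σ, -, hmin, hD⟩ := h
  let s : Set V := {x | σ y ≤ σ x}
  have hminor : IsShallowMinor 0 (G.induce s) G := by
    refine ⟨fun w => {(w : V)}, fun w => w, fun w => rfl, fun a b hab => ?_, ?_, fun a b hab => ?_⟩
    · exact Set.disjoint_singleton.mpr fun h => hab (Subtype.ext h)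
    · rintro w x rfl
      exact LinkedIn.refl 0 rfl
    · exact ⟨a, rfl, b, rfl, hab⟩
  have hedges := hminor.ncard_edgeSet_le hc
  rw [← SimpleGraph.coe_edgeFinset, Set.ncard_coe_finset] at hedges
  have hdeg : ∀ x : s, {x | D.Adj x y}.ncard ≤ (G.induce s).degree x := by
    intro x
    calc {x | D.Adj x y}.ncard ≤ {w | G.Adj y w ∧ σ y ≤ σ w}.ncard :=
          Set.ncard_le_ncard fun w hw =>
            ⟨((hD w y).mp hw).1.symm, ((hD w y).mp hw).2.le⟩
      _ ≤ {w | G.Adj x w ∧ σ y ≤ σ w}.ncard := hmin y x x.2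
      _ = (Subtype.val '' (G.induce s).neighborSet x).ncard := by
          congr 1
          ext w
          simp [s, and_comm]
      _ = (G.induce s).degree x := by
          rw [Set.ncard_image_of_injective _ Subtype.val_injective, ← Nat.card_coe_set_eq,
            Nat.card_eq_fintype_card, SimpleGraph.card_neighborSet_eq_degree]
  have hsum := (G.induce s).sum_degrees_eq_twice_card_edges
  have hle := Finset.card_nsmul_le_sum Finset.univ (fun x => (G.induce s).degree x) _
    fun x _ => hdeg x
  rw [hsum, smul_eq_mul, Finset.card_univ] at hle
  have hpos : 0 < Fintype.card s := Fintype.card_pos_iff.mpr ⟨⟨y, le_refl (σ y)⟩⟩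
  refine Nat.le_of_mul_le_mul_left (hle.trans ?_) hpos
  linarith

/-! ### Augmentations preserve sparsity of shallow minors -/

/-- The graph of all pairs that are joined by an arc of `D`, or that the transitivity or the
fraternity rule joins in an augmentation of `D`. -/
def augGraph {V : Type u} (D : Digraph V) : SimpleGraph V :=
  SimpleGraph.fromRel fun x y => D.Adj x y ∨ ∃ z, D.Adj x z ∧ (D.Adj z y ∨ D.Adj y z)

theorem LinkedIn.of_arc {V : Type u} {D : Digraph V} {B : Set V} {x y : V} (h : D.Adj x y)
    (hx : x ∈ B) (hy : y ∈ B) : LinkedIn D.toSimpleGraphInclusive B 1 x y := by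
  rcases eq_or_ne x y with rfl | hne
  · exact LinkedIn.refl 1 hx
  · exact LinkedIn.of_adj ⟨hne, Or.inl h⟩ hx hy

/-- A walk in `augGraph D` becomes a walk of at most twice the length in `D`, whose new vertices
are out-neighbours of old ones. -/
theorem LinkedIn.of_augGraph {V : Type u} {D : Digraph V} {B : Set V} {n : ℕ} {x y : V}
    (h : LinkedIn (augGraph D) B n x y) :
    LinkedIn D.toSimpleGraphInclusive (B ∪ {z | ∃ x ∈ B, D.Adj x z}) (2 * n) x y := by
  have step : ∀ {x y}, x ∈ B → y ∈ B →
      (D.Adj x y ∨ ∃ z, D.Adj x z ∧ (D.Adj z y ∨ D.Adj y z)) →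
      LinkedIn D.toSimpleGraphInclusive (B ∪ {z | ∃ x ∈ B, D.Adj x z}) 2 x y := by
    intro x y hx hy h
    rcases h with h | ⟨z, hxz, h⟩
    · exact (LinkedIn.of_arc h (Or.inl hx) (Or.inl hy)).mono le_rfl subset_rfl (by omega)
    · have hz : z ∈ B ∪ {z | ∃ x ∈ B, D.Adj x z} := Or.inr ⟨x, hx, hxz⟩
      have h₁ := LinkedIn.of_arc hxz (Or.inl hx) hz
      rcases h with h | h
      · exact h₁.trans (LinkedIn.of_arc h hz (Or.inl hy))
      · exact h₁.trans (LinkedIn.of_arc h (Or.inl hy) hz).symm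
  obtain ⟨p, hp, hpB⟩ := h
  induction p generalizing n with
  | nil => exact LinkedIn.refl _ (Or.inl (hpB _ (by simp)))
  | @cons x y _ hxy q ih =>
    rw [SimpleGraph.Walk.length_cons] at hp
    obtain ⟨m, rfl⟩ : ∃ m, n = m + 1 := ⟨n - 1, by omega⟩
    have hx : x ∈ B := hpB x (by simp)
    have hy : y ∈ B := hpB y (by simp)
    have hrest := ih (n := m) (by omega) fun z hz => hpB z (by simp [hz])
    have h₁ : LinkedIn D.toSimpleGraphInclusive (B ∪ {z | ∃ x ∈ B, D.Adj x z}) 2 x y := by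
      rcases hxy.2 with h | h
      · exact step hx hy h
      · exact (step hy hx h).symm
    exact (h₁.trans hrest).mono le_rfl subset_rfl (by omega)

/-- Adding to each branch set the out-neighbours of its vertices turns an `r`-shallow minor of
`augGraph D` into an overlapping `(2 * r + 1)`-shallow minor of `D`; a vertex lies in at most one
new branch set for itself and one for each of its in-neighbours. -/
theorem grad_augGraph_le {V : Type u} [Fintype V] {D : Digraph V} {d r c : ℕ}
    (hd : maxInDegree D ≤ d) (hc : grad (2 * r + 1) D.toSimpleGraphInclusive ≤ c) :
    grad r (augGraph D) ≤
      (((d + 1) + (d + 1) ^ (2 * (2 * r + 1) + 2) * c : ℕ) : ℝ≥0∞) := by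
  refine grad_le_natCast fun k H hH => ?_
  obtain ⟨B, ctr, hctr, hdisj, hrad, hadj⟩ := hH
  have h := ncard_edgeSet_le_of_overlapping (d := d) hc H
    (fun w => B w ∪ {z | ∃ x ∈ B w, D.Adj x z}) ctr (fun w => Or.inl (hctr w)) ?_ ?_ ?_
  · simpa using h
  · intro v
    calc {w | v ∈ B w ∪ {z | ∃ x ∈ B w, D.Adj x z}}.ncard
        ≤ {w | ∃ x ∈ B w, x ∈ insert v {x | D.Adj x v}}.ncard := by
          refine Set.ncard_le_ncard ?_
          rintro w (hw | ⟨x, hx, hxv⟩)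
          · exact ⟨v, hw, Or.inl rfl⟩
          · exact ⟨x, hx, Or.inr hxv⟩
      _ ≤ (insert v {x | D.Adj x v}).ncard := ncard_meeting_le hdisj _
      _ ≤ {x | D.Adj x v}.ncard + 1 := Set.ncard_insert_le _ _
      _ ≤ d + 1 := Nat.succ_le_succ ((ncard_le_maxInDegree D v).trans hd)
  · rintro w z (hz | ⟨x, hx, hxz⟩)
    · exact (LinkedIn.of_augGraph (hrad w z hz)).mono le_rfl subset_rfl (by omega)
    · exact (LinkedIn.of_augGraph (hrad w x hx)).trans
        (LinkedIn.of_arc hxz (Or.inl hx) (Or.inr ⟨x, hx, hxz⟩))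
  · have key : ∀ {a b x y}, x ∈ B a → y ∈ B b →
        (D.Adj x y ∨ ∃ z, D.Adj x z ∧ (D.Adj z y ∨ D.Adj y z)) →
        ∃ x' ∈ B a ∪ {z | ∃ x ∈ B a, D.Adj x z}, ∃ y' ∈ B b ∪ {z | ∃ x ∈ B b, D.Adj x z},
          x' = y' ∨ D.toSimpleGraphInclusive.Adj x' y' := by
      intro a b x y hx hy h
      rcases h with h | ⟨z, hxz, h | h⟩
      · exact ⟨y, Or.inr ⟨x, hx, h⟩, y, Or.inl hy, Or.inl rfl⟩
      · refine ⟨z, Or.inr ⟨x, hx, hxz⟩, y, Or.inl hy, ?_⟩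
        exact (eq_or_ne z y).imp_right fun hne => ⟨hne, Or.inl h⟩
      · exact ⟨z, Or.inr ⟨x, hx, hxz⟩, z, Or.inr ⟨y, hy, h⟩, Or.inl rfl⟩
    intro a b hab
    obtain ⟨x, hx, y, hy, hxy⟩ := hadj a b hab
    rcases hxy.2 with h | h
    · exact key hx hy h
    · obtain ⟨y', hy', x', hx', h'⟩ := key hy hx h
      exact ⟨x', hx', y', hy', h'.imp Eq.symm SimpleGraph.Adj.symm⟩

theorem IsTransFratAug.toSimpleGraphInclusive_le_augGraph {V : Type u} {D D' : Digraph V}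
    (h : IsTransFratAug D D') : D'.toSimpleGraphInclusive ≤ augGraph D := by
  have key : ∀ {x y}, D'.Adj x y →
      D.Adj x y ∨ ∃ z, D.Adj x z ∧ (D.Adj z y ∨ D.Adj y z) := by
    intro x y hxy
    by_cases hD : D.Adj x y
    · exact Or.inl hD
    · obtain ⟨-, z, h | h⟩ := h.tightness x y hxy hD
      exacts [Or.inr ⟨z, h.1, Or.inl h.2⟩, Or.inr ⟨z, h.1, Or.inr h.2⟩]
  intro x y hxy
  exact ⟨hxy.1, hxy.2.imp key key⟩

/-- The three terms count the old arcs, the transitive arcs, and the oriented fraternal pairs. -/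
theorem IsGreedyAug.maxInDegree_le {V : Type u} [Fintype V] {D D' : Digraph V} {d c : ℕ}
    (h : IsGreedyAug D D') (hd : maxInDegree D ≤ d) (hc : grad 0 (augGraph D) ≤ c) :
    maxInDegree D' ≤ d + d * d + 2 * c := by
  classical
  obtain ⟨-, F, O, hF, hO, hD'⟩ := h
  have hFle : F ≤ augGraph D := fun x y hxy => by
    obtain ⟨z, hz⟩ := hF x y hxy
    exact ⟨hxy.ne, Or.inl (Or.inr ⟨z, hz.1, Or.inr hz.2⟩)⟩
  have hin : ∀ y, {x | D.Adj x y}.ncard ≤ d := fun y => (ncard_le_maxInDegree D y).trans hd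
  refine _root_.maxInDegree_le fun y => ?_
  let N : Finset V := Finset.univ.filter fun z => D.Adj z y
  have hN : N.card ≤ d := by
    rw [← Set.ncard_coe_finset]; simpa [N] using hin y
  have htrans : (⋃ z ∈ N, {x | D.Adj x z}).ncard ≤ d * d :=
    (Finset.set_ncard_biUnion_le N fun z => {x | D.Adj x z}).trans
      ((Finset.sum_le_card_nsmul _ _ d fun z _ => hin z).trans (Nat.mul_le_mul_right d hN))
  have hsub : {x | D'.Adj x y} ⊆
      ({x | D.Adj x y} ∪ ⋃ z ∈ N, {x | D.Adj x z}) ∪ {x | O.Adj x y} := by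
    intro x hx
    rcases (hD' x y).mp hx with h | ⟨-, z, hxz, hzy⟩ | h
    · exact Or.inl (Or.inl h)
    · refine Or.inl (Or.inr ?_)
      simp only [Set.mem_iUnion]
      exact ⟨z, by simpa [N] using hzy, hxz⟩
    · exact Or.inr h
  have h₁ := hin y
  have h₂ := hO.ncard_le ((grad_mono hFle 0).trans hc) y
  have h₃ := Set.ncard_union_le {x | D.Adj x y} (⋃ z ∈ N, {x | D.Adj x z})
  have h₄ := Set.ncard_union_le ({x | D.Adj x y} ∪ ⋃ z ∈ N, {x | D.Adj x z}) {x | O.Adj x y}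
  have h₅ := Set.ncard_le_ncard hsub (Set.toFinite _)
  omega

theorem IsFlip.toSimpleGraphInclusive_le {V : Type u} [Fintype V] {D D' : Digraph V}
    (h : IsFlip D D') : D'.toSimpleGraphInclusive ≤ D.toSimpleGraphInclusive := by
  have key : ∀ {x y}, D'.Adj x y → D.Adj x y ∨ D.Adj y x := fun {x y} hxy =>
    (em (D.Adj x y)).imp_right (h.reversed x y hxy)
  intro x y hxy
  exact ⟨hxy.1, hxy.2.elim key fun h => (key h).symm⟩

theorem IsGreedyOrientation.toSimpleGraphInclusive_eq {V : Type u} {G : SimpleGraph V}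
    {D : Digraph V} (h : IsGreedyOrientation G D) : D.toSimpleGraphInclusive = G := by
  obtain ⟨σ, hinj, -, hD⟩ := h
  ext x y
  constructor
  · rintro ⟨-, h | h⟩
    exacts [((hD x y).mp h).1, ((hD y x).mp h).1.symm]
  · intro h
    refine ⟨h.ne, ?_⟩
    rcases lt_or_gt_of_ne (hinj.ne h.ne) with hlt | hlt
    · exact Or.inr ((hD y x).mpr ⟨h.symm, hlt⟩)
    · exact Or.inl ((hD x y).mpr ⟨h, hlt⟩)

/-- After `i` steps from a graph whose gradients are bounded by `f`, the indegrees and all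
gradients are bounded in terms of `f` and `i`. -/
theorem exists_bound_of_grad_le (A : GreedyAlgorithm.{u}) (f : ℕ → ℕ) (i : ℕ) :
    ∃ (d : ℕ) (F : ℕ → ℕ), ∀ (G : FinGraph.{u}) (S : ℕ → Digraph G.V),
      IsTransFratFlipAug A G S → (∀ r, grad r G.graph ≤ f r) →
        maxInDegree (S i) ≤ d ∧ ∀ r, grad r (S i).toSimpleGraphInclusive ≤ F r := by
  induction i with
  | zero =>
    refine ⟨2 * f 0, f, fun G S hS hf => ?_⟩
    have h := A.orient_spec G.V G.graph
    rw [hS.zero, h.toSimpleGraphInclusive_eq]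
    exact ⟨maxInDegree_le (h.ncard_le (hf 0)), hf⟩
  | succ i ih =>
    obtain ⟨d, F, h⟩ := ih
    let F' : ℕ → ℕ := fun r => (d + 1) + (d + 1) ^ (2 * (2 * r + 1) + 2) * F (2 * r + 1)
    refine ⟨(d + 1) + (d + d * d + 2 * F' 0), fun r => F r + F' r, fun G S hS hf => ?_⟩
    obtain ⟨hd, hF⟩ := h G S hS hf
    rcases hS.step i with hflip | haug
    · refine ⟨?_, fun r => ?_⟩
      · have := hflip.indegree
        omega
      · refine ((grad_mono hflip.toSimpleGraphInclusive_le r).trans (hF r)).trans ?_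
        exact_mod_cast Nat.le_add_right _ _
    · have hspec := A.augment_spec G.V (S i)
      rw [← haug] at hspec
      have hgrad : ∀ r, grad r (augGraph (S i)) ≤ F' r := fun r =>
        grad_augGraph_le hd (hF (2 * r + 1))
      refine ⟨(hspec.maxInDegree_le hd (hgrad 0)).trans (Nat.le_add_left _ _), fun r => ?_⟩
      refine ((grad_mono hspec.1.toSimpleGraphInclusive_le_augGraph r).trans (hgrad r)).trans ?_
      exact_mod_cast Nat.le_add_left _ _

/-! ### Augmentations shorten walks -/

theorem IsTransFratAug.toSimpleGraphInclusive_mono {V : Type u} {D D' : Digraph V}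
    (h : IsTransFratAug D D') : D.toSimpleGraphInclusive ≤ D'.toSimpleGraphInclusive :=
  fun x y hxy => ⟨hxy.1, hxy.2.imp (h.le x y) (h.le y x)⟩

/-- The middle vertex of a walk with two edges can be skipped unless both its edges leave it. -/
theorem IsTransFratAug.eq_or_adj {V : Type u} {D D' : Digraph V} (h : IsTransFratAug D D')
    {a b c : V} (hab : D.Adj a b) (hbc : D.Adj b c ∨ D.Adj c b) :
    a = c ∨ D'.toSimpleGraphInclusive.Adj a c := by
  refine (eq_or_ne a c).imp_right fun hne => ⟨hne, ?_⟩
  rcases hbc with hbc | hcb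
  · exact Or.inl (h.transitivity a b c hne hab hbc)
  · exact h.fraternity a b c hne hab hcb

/-- In a walk with at least three edges one of the first two inner vertices has an incoming arc
from the other, so an augmentation makes a shortcut around it. -/
theorem IsTransFratAug.linkedIn_shorten {V : Type u} {D D' : Digraph V} (h : IsTransFratAug D D')
    {B : Set V} {n : ℕ} {x y : V} (hxy : LinkedIn D.toSimpleGraphInclusive B (n + 3) x y) :
    LinkedIn D'.toSimpleGraphInclusive B (n + 2) x y := by
  obtain ⟨p, hp, hpB⟩ := hxy
  by_cases hlen : p.length ≤ n + 2
  · exact LinkedIn.mono ⟨p, hlen, hpB⟩ h.toSimpleGraphInclusive_mono subset_rfl le_rfl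
  match p, hp, hpB, hlen with
  | .nil, _, _, hlen => simp at hlen
  | .cons _ .nil, _, _, hlen => simp at hlen
  | .cons _ (.cons _ .nil), _, _, hlen => simp at hlen
  | .cons (v := b) hab (.cons (v := c) hbc (.cons (v := d) hcd q)), hp, hpB, hlen =>
    simp only [SimpleGraph.Walk.length_cons] at hp
    have hx : x ∈ B := hpB x (by simp)
    have hb : b ∈ B := hpB b (by simp)
    have hc : c ∈ B := hpB c (by simp)
    have hd : d ∈ B := hpB d (by simp)
    have hq : LinkedIn D'.toSimpleGraphInclusive B n d y :=
      LinkedIn.mono (n := n) ⟨q, le_rfl, fun z hz => hpB z (by simp [hz])⟩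
        h.toSimpleGraphInclusive_mono subset_rfl (by omega)
    have of_or : ∀ {s t}, s ∈ B → t ∈ B → (s = t ∨ D'.toSimpleGraphInclusive.Adj s t) →
        LinkedIn D'.toSimpleGraphInclusive B 1 s t := by
      rintro s t hs ht (rfl | hst)
      exacts [LinkedIn.refl 1 hs, LinkedIn.of_adj hst hs ht]
    have old : ∀ {s t}, s ∈ B → t ∈ B → D.toSimpleGraphInclusive.Adj s t →
        LinkedIn D'.toSimpleGraphInclusive B 1 s t := fun hs ht hst =>
      LinkedIn.of_adj (h.toSimpleGraphInclusive_mono hst) hs ht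
    have hxd : LinkedIn D'.toSimpleGraphInclusive B 2 x d := by
      rcases hbc.2 with hbc | hcb
      · exact (old hx hb hab).trans (of_or hb hd (h.eq_or_adj hbc hcd.2))
      · exact (of_or hc hx (h.eq_or_adj hcb hab.2.symm)).symm.trans (old hc hd hcd)
    exact (hxd.trans hq).mono le_rfl subset_rfl (by omega)

/-- The ends of a walk with at most two edges are joined after an augmentation, except if both
edges are arcs leaving the middle vertex only. -/
theorem IsTransFratAug.joined_of_linkedIn_two {V : Type u} {D D' : Digraph V}
    (h : IsTransFratAug D D') {B : Set V} {x y : V} (hne : x ≠ y)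
    (hxy : LinkedIn D.toSimpleGraphInclusive B 2 x y) :
    D'.Adj x y ∨ D'.Adj y x ∨ ∃ z ∈ B, D'.Adj z x ∧ D'.Adj z y := by
  have old : ∀ {s t}, D.toSimpleGraphInclusive.Adj s t → D'.Adj s t ∨ D'.Adj t s := fun hst =>
    (h.toSimpleGraphInclusive_mono hst).2
  obtain ⟨p, hp, hpB⟩ := hxy
  match p, hp, hpB with
  | .nil, _, _ => exact absurd rfl hne
  | .cons hab .nil, _, _ => exact (old hab).imp_right Or.inl
  | .cons (v := b) hab (.cons hbc .nil), _, hpB =>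
    have hb : b ∈ B := hpB b (by simp)
    rcases hab.2 with hab | hba
    · rcases h.eq_or_adj hab hbc.2 with h' | h'
      · exact absurd h' hne
      · exact h'.2.imp_right Or.inl
    rcases hbc.2 with hbc | hcb
    · exact Or.inr (Or.inr ⟨b, hb, h.le _ _ hba, h.le _ _ hbc⟩)
    · rcases h.eq_or_adj hcb (Or.inl hba) with h' | h'
      · exact absurd h'.symm hne
      · exact h'.2.symm.imp_right Or.inl
  | .cons _ (.cons _ (.cons _ _)), hp, _ =>
    simp only [SimpleGraph.Walk.length_cons] at hp
    omega

theorem linkedIn_two_of_isTransFratAug {V : Type u} {S : ℕ → Digraph V}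
    (hS : ∀ i, IsTransFratAug (S i) (S (i + 1))) {B : Set V} {x y : V} (n i : ℕ)
    (h : LinkedIn (S i).toSimpleGraphInclusive B (n + 2) x y) :
    LinkedIn (S (i + n)).toSimpleGraphInclusive B 2 x y := by
  induction n generalizing i with
  | zero => exact h
  | succ n ih =>
    have := ih (i + 1) ((hS i).linkedIn_shorten h)
    rwa [show i + 1 + n = i + (n + 1) by omega] at this

/-- The centers of two adjacent branch sets are joined by a walk of length `2 * r + 1` inside the
union of the sets. After `2 * r + 1` augmentations one of the two centers has an in-neighbour in the
other branch set, and a center has at most as many in-neighbours as the maximal indegree. -/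
theorem grad_le_of_isTransFratAug {V : Type u} [Fintype V] {S : ℕ → Digraph V}
    (hS : ∀ i, IsTransFratAug (S i) (S (i + 1))) (r : ℕ) :
    grad r (S 0).toSimpleGraphInclusive ≤ maxInDegree (S (2 * r + 1)) := by
  refine grad_le_natCast fun k H hH => ?_
  obtain ⟨B, ctr, hctr, hdisj, hrad, hadj⟩ := hH
  have h := ncard_le_of_orientation (E := H.edgeSet) (d := maxInDegree (S (2 * r + 1)))
    (fun a b => ∃ z ∈ B a, z ∈ {z | (S (2 * r + 1)).Adj z (ctr b)}) ?_ fun b =>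
      (ncard_meeting_le hdisj _).trans (ncard_le_maxInDegree _ _)
  · simpa using h
  intro a b hab
  obtain ⟨x, hx, y, hy, hxy⟩ := hadj a b hab
  have hne : ctr a ≠ ctr b := fun h =>
    Set.disjoint_left.mp (hdisj a b hab.ne) (hctr a) (h ▸ hctr b)
  have hx' : LinkedIn _ (B a ∪ B b) r (ctr a) x :=
    LinkedIn.mono (hrad a x hx) le_rfl Set.subset_union_left le_rfl
  have hy' : LinkedIn _ (B a ∪ B b) r (ctr b) y :=
    LinkedIn.mono (hrad b y hy) le_rfl Set.subset_union_right le_rfl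
  have hlink := ((hx'.trans (LinkedIn.of_adj hxy (Or.inl hx) (Or.inr hy))).trans hy'.symm).mono
    le_rfl subset_rfl (show r + 1 + r ≤ 2 * r + 2 by omega)
  have htwo := linkedIn_two_of_isTransFratAug hS (2 * r) 0 hlink
  rw [Nat.zero_add] at htwo
  rcases (hS (2 * r)).joined_of_linkedIn_two hne htwo with h | h | ⟨z, hz | hz, hza, hzb⟩
  · exact Or.inl ⟨_, hctr a, h⟩
  · exact Or.inr ⟨_, hctr b, h⟩
  · exact Or.inl ⟨z, hz, hzb⟩
  · exact Or.inr ⟨z, hz, hza⟩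

theorem mainTheorem8 (A : GreedyAlgorithm.{u}) (C : Set FinGraph.{u}) :
    BoundedExpansion C ↔
      ∃ Γ : ℕ → ℕ, ∀ G ∈ C, ∀ S : ℕ → Digraph G.V, IsTransFratFlipAug A G S →
        ∀ i : ℕ, maxInDegree (S i) ≤ Γ i := by
  constructor
  · rintro ⟨f, hf⟩
    choose d F h using exists_bound_of_grad_le A fun r => ⌈f r⌉₊
    refine ⟨d, fun G hG S hS i => (h i G S hS fun r => (hf r G hG).trans ?_).1⟩
    exact_mod_cast Nat.le_ceil (f r)
  · rintro ⟨Γ, hΓ⟩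
    refine ⟨fun r => Γ (2 * r + 1), fun r G hG => ?_⟩
    let S : ℕ → Digraph G.V := fun i => (A.augment G.V)^[i] (A.orient G.V G.graph)
    have hsucc : ∀ i, S (i + 1) = A.augment G.V (S i) := fun i =>
      Function.iterate_succ_apply' _ _ _
    have hS : ∀ i, IsTransFratAug (S i) (S (i + 1)) := fun i => by
      rw [hsucc]; exact (A.augment_spec G.V (S i)).1
    have hgrad := grad_le_of_isTransFratAug hS r
    have hzero : (S 0).toSimpleGraphInclusive = G.graph :=
      (A.orient_spec G.V G.graph).toSimpleGraphInclusive_eq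
    rw [hzero] at hgrad
    refine hgrad.trans ?_
    rw [ENNReal.coe_natCast]
    exact_mod_cast hΓ G hG S ⟨rfl, fun i => Or.inr (hsucc i)⟩ (2 * r + 1)
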